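/- All graphs are finite, and $\mathrm{td}$ denotes treedepth: $\mathrm{td}(G)$ is the minimum height (maximum number of vertices on a root-to-leaf path) of a rooted forest $F$ for which there is an injective map $f:V(G)\to V(F)$ such that $f(u),f(v)$ are in ancestor-descendant relation in $F$ for every $uv\in E(G)$. A tree decomposition of a graph $G$ is a pair $(T,\beta)$, where $T$ is a rooted tree and $\beta:V(T)\to 2^{V(G)}$ is such that for every $v\in V(G)$ the set $\{t\in V(T) : v\in\beta(t)\}$ induces a nonempty connected subtree of $T$, and for every $uv\in E(G)$ there is $t\in V(T)$ with $u,v\in\beta(t)$. Every node counts as an ancestor and as a descendant of itself. A tree decomposition $(T,\beta)$ of $G$ is greedy if 1. $V(T)=V(G)$, where each vertex $v$ of $G$ is identified with the topmost node whose bag contains $v$; that is, $v\in\beta(v)$, and $v\in\beta(t)$ implies that $v$ is an ancestor of $t$ in $T$; 2. for every $uv\in E(G)$, the nodes $u$ and $v$ are in ancestor-descendant relation in $T$; and 3. for every $u\in V(T)$ and every child $v$ of $u$ in $T$ there is a descendant $w$ of $v$ in $T$ such that $uw\in E(G)$. Statement. There is an absolute constant $c>0$ such that the following holds. Let $G$ be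 a connected graph, let $(T,\beta)$ be a greedy tree decomposition of $G$, and let $\tau\ge 2$ be a real number such that $|\beta(t)|\le\tau$ for every $t\in V(T)$. Then $G$ contains, as a (not necessarily induced) subgraph, a tree $H$ of maximum degree at most $3$ with $$\mathrm{td}(H)\ \ge\ c\cdot\frac{\mathrm{td}(T)}{\log_2\tau}.$$ -/

import Mathlib

universe u v

/-- A rooted forest on the vertex set `W`, presented by its ancestor relation: `anc a d` says that
`a` is an ancestor of `d` (every vertex being an ancestor of itself). The ancestors of any given
vertex form a chain. -/
structure RootedForest (W : Type u) where
  anc : W → W → Prop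
  anc_refl : ∀ a, anc a a
  anc_antisymm : ∀ a b, anc a b → anc b a → a = b
  anc_trans : ∀ a b c, anc a b → anc b c → anc a c
  anc_chain : ∀ a b d, anc a d → anc b d → anc a b ∨ anc b a

/-- The height of a (finite) rooted forest: the largest number of vertices on a path from a root
down to a vertex `d`, that is, the largest number of ancestors of a vertex `d` (itself included).
The empty forest has height `0`. -/
noncomputable def RootedForest.height {W : Type u} (F : RootedForest W) : ℕ :=
  ⨆ d : W, {a : W | F.anc a d}.ncard

namespace SimpleGraph

/-- `(F, f)` is a treedepth decomposition of `G`: the map `f` from the vertices of `G` to the nodes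
of the rooted forest `F` is injective, and adjacent vertices of `G` are sent to nodes in
ancestor-descendant relation. -/
def IsTreedepthDecomposition {V : Type u} (G : SimpleGraph V) {W : Type v} (F : RootedForest W)
    (f : V → W) : Prop :=
  Function.Injective f ∧ ∀ x y : V, G.Adj x y → F.anc (f x) (f y) ∨ F.anc (f y) (f x)

/-- The treedepth of a finite graph: the minimum height of a treedepth decomposition. -/
noncomputable def treedepth {V : Type u} (G : SimpleGraph V) : ℕ :=
  sInf {k : ℕ | ∃ (W : Type u) (_ : Finite W) (F : RootedForest W) (f : V → W),
    G.IsTreedepthDecomposition F f ∧ F.height = k}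

/-- A tree decomposition of `G`, with a rooted tree whose set of nodes is `N`. -/
structure TreeDecomposition {V : Type u} (G : SimpleGraph V) (N : Type v) where
  tree : SimpleGraph N
  root : N
  bag : N → Finset V
  isTree : tree.IsTree
  /-- The nodes whose bags contain `x` induce a nonempty connected subgraph of the tree. -/
  connected_bags : ∀ x : V, (tree.induce {t : N | x ∈ bag t}).Connected
  exists_bag_of_adj : ∀ x y : V, G.Adj x y → ∃ t : N, x ∈ bag t ∧ y ∈ bag t

namespace TreeDecomposition

variable {V : Type u} {G : SimpleGraph V} {N : Type v}

/-- The node `a` is an ancestor of `d` (possibly `a = d`): it lies on the path from the root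
to `d`. -/
def IsAncestor (D : G.TreeDecomposition N) (a d : N) : Prop :=
  ∃ p : D.tree.Walk D.root d, p.IsPath ∧ a ∈ p.support

/-- The node `b` is a child of the node `a`. -/
def IsChild (D : G.TreeDecomposition N) (b a : N) : Prop :=
  D.tree.Adj a b ∧ D.IsAncestor a b

/-- A greedy tree decomposition of `G`. The nodes of the tree are the vertices of `G`
(so the type of nodes is `V`), where a vertex `x` is identified with the topmost of the nodes whose
bags contain `x`. -/
structure IsGreedy (D : G.TreeDecomposition V) : Prop where
  mem_bag_self : ∀ x : V, x ∈ D.bag x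
  isAncestor_of_mem_bag : ∀ x t : V, x ∈ D.bag t → D.IsAncestor x t
  isAncestor_or_of_adj : ∀ x y : V, G.Adj x y → D.IsAncestor x y ∨ D.IsAncestor y x
  exists_adj_of_isChild : ∀ x y : V, D.IsChild y x → ∃ z : V, D.IsAncestor y z ∧ G.Adj x z

end TreeDecomposition

end SimpleGraph

/-! For each non-root node `b`, greediness supplies an edge of `G` from the parent of `b` into the
subtree below `b`. Choosing one edge per `b` gives fewer edges than vertices, yet bottom-up every
subtree of `T` is connected in the chosen graph `S`; hence `S` is a spanning tree of `G`
(`IsGreedy.exists_spanningTree`). Two inequalities finish the proof.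

First, td(T) = O(log τ) · td(S) (`IsGreedy.tdLE_tree`), by induction on td(S[A]) for `T`-connected
sets `A` in which at most three vertices have `T`-neighbours outside. A component of S[A] that
misses the top of `A` has an `S`-edge leaving `A` downwards, so it meets the bag of one of these
boundary vertices (`IsGreedy.exists_mem_compOn`). Thus S[A] has O(τ) components, and one vertex from
each can be deleted to lower its treedepth. In `T`, centroid deletions remove these O(τ) vertices in
depth O(log τ) and leave pieces that again have at most three boundary vertices
(`tdLE_of_ncard_marked_le`).

Second, a tree of treedepth above 2k contains a subcubic subtree of treedepth above k
(`exists_subcubic_marked`). Large treedepth gives an edge with both sides of treedepth at least one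
less; recursion on the sides and rejoining along the edge works once prescribed vertices are kept
with spare degree.

Treedepth is handled through the recursive predicate `TdLE` on vertex sets and connectivity through
cuts, so that subsets never become separate graphs. -/

namespace SimpleGraph

variable {V : Type u}

/-- The vertex set `A` is nonempty and induces a connected subgraph of `G`, expressed through cuts:
a nonempty part of `A` without edges to the rest of `A` is all of `A`. -/
def ConnOn (G : SimpleGraph V) (A : Set V) : Prop :=
  A.Nonempty ∧ ∀ B ⊆ A, B.Nonempty → (∀ x ∈ B, ∀ y ∈ A, G.Adj x y → y ∈ B) → B = A

/-- The connected component of `x` in the subgraph of `G` induced by `A` (for `x ∈ A`). -/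
def compOn (G : SimpleGraph V) (A : Set V) (x : V) : Set V :=
  {y | Relation.ReflTransGen (fun a b => G.Adj a b ∧ b ∈ A) x y}

/-- The subgraph of `G` induced by `A` has treedepth at most `n`: one can delete a vertex from each
connected vertex set so that the rest has treedepth at most `n - 1`. -/
def TdLE (G : SimpleGraph V) : ℕ → Set V → Prop
  | 0, A => A = ∅
  | n + 1, A => ∀ C ⊆ A, G.ConnOn C → ∃ x ∈ C, TdLE G n (C \ {x})

/-! ### Connected vertex sets and components -/

section ConnOn

variable {G : SimpleGraph V} {A B C : Set V}

lemma ConnOn.subset_of (h : G.ConnOn A) {x : V} (hxA : x ∈ A) (hxB : x ∈ B)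
    (hB : ∀ a ∈ A, a ∈ B → ∀ y ∈ A, G.Adj a y → y ∈ B) : A ⊆ B := by
  have := h.2 (A ∩ B) Set.inter_subset_left ⟨x, hxA, hxB⟩
    (fun a ha y hy hay => ⟨hy, hB a ha.1 ha.2 y hy hay⟩)
  exact Set.inter_eq_left.mp this

lemma connOn_of_subset {x : V} (hx : x ∈ A)
    (h : ∀ B ⊆ A, B.Nonempty → (∀ x ∈ B, ∀ y ∈ A, G.Adj x y → y ∈ B) → A ⊆ B) : G.ConnOn A :=
  ⟨⟨x, hx⟩, fun B hB hne hcl => hB.antisymm (h B hB hne hcl)⟩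

lemma connOn_singleton (x : V) : G.ConnOn {x} := by
  refine connOn_of_subset rfl fun B hB hne _ => ?_
  obtain ⟨y, hy⟩ := hne
  obtain rfl : y = x := hB hy
  simpa using hy

lemma ConnOn.mono_graph {G' : SimpleGraph V} (h : G.ConnOn A) (hG : G ≤ G') : G'.ConnOn A :=
  ⟨h.1, fun B hB hne hcl => h.2 B hB hne fun x hx y hy hxy => hcl x hx y hy (hG hxy)⟩

lemma ConnOn.exists_adj (h : G.ConnOn A) (hB : B ⊆ A) (hne : B.Nonempty) (hBA : B ≠ A) :
    ∃ x ∈ B, ∃ y ∈ A, y ∉ B ∧ G.Adj x y := by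
  by_contra! hcon
  exact hBA (h.2 B hB hne fun x hx y hy hxy => by
    by_contra hyB
    exact hcon x hx y hy hyB hxy)

lemma ConnOn.union (hA : G.ConnOn A) (hB : G.ConnOn B) (h : (A ∩ B).Nonempty) :
    G.ConnOn (A ∪ B) := by
  obtain ⟨z, hzA, hzB⟩ := h
  refine connOn_of_subset (Or.inl hzA) fun D hD hne hcl => ?_
  have hcA : ∀ a ∈ A, a ∈ D → ∀ y ∈ A, G.Adj a y → y ∈ D :=
    fun a _ ha y hy => hcl a ha y (Or.inl hy)
  have hcB : ∀ a ∈ B, a ∈ D → ∀ y ∈ B, G.Adj a y → y ∈ D :=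
    fun a _ ha y hy => hcl a ha y (Or.inr hy)
  have hz : z ∈ D := by
    obtain ⟨d, hd⟩ := hne
    rcases hD hd with hdA | hdB
    · exact hA.subset_of hdA hd hcA hzA
    · exact hB.subset_of hdB hd hcB hzB
  exact Set.union_subset (hA.subset_of hzA hz hcA) (hB.subset_of hzB hz hcB)

lemma ConnOn.join (hA : G.ConnOn A) (hB : G.ConnOn B) {a b : V} (ha : a ∈ A) (hb : b ∈ B)
    (hab : G.Adj a b) : G.ConnOn (A ∪ B) := by
  refine connOn_of_subset (Or.inl ha) fun D hD hne hcl => ?_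
  have hcA : ∀ a ∈ A, a ∈ D → ∀ y ∈ A, G.Adj a y → y ∈ D :=
    fun a _ ha y hy => hcl a ha y (Or.inl hy)
  have hcB : ∀ a ∈ B, a ∈ D → ∀ y ∈ B, G.Adj a y → y ∈ D :=
    fun a _ ha y hy => hcl a ha y (Or.inr hy)
  obtain ⟨d, hd⟩ := hne
  rcases hD hd with hdA | hdB
  · have h1 := hA.subset_of hdA hd hcA
    exact Set.union_subset h1 (hB.subset_of hb (hcl a (h1 ha) b (Or.inr hb) hab) hcB)
  · have h1 := hB.subset_of hdB hd hcB
    exact Set.union_subset (hA.subset_of ha (hcl b (h1 hb) a (Or.inl ha) hab.symm) hcA) h1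

lemma mem_compOn_self (x : V) : x ∈ G.compOn A x := Relation.ReflTransGen.refl

lemma compOn_subset {x : V} (hx : x ∈ A) : G.compOn A x ⊆ A := by
  intro y hy
  induction hy with
  | refl => exact hx
  | tail _ h _ => exact h.2

lemma compOn_closed {x y z : V} (hy : y ∈ G.compOn A x) (hz : z ∈ A) (hyz : G.Adj y z) :
    z ∈ G.compOn A x := Relation.ReflTransGen.tail hy ⟨hyz, hz⟩

lemma connOn_compOn (x : V) : G.ConnOn (G.compOn A x) := by
  refine connOn_of_subset (mem_compOn_self x) fun B hB hne hcl => ?_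
  obtain ⟨y, hy⟩ := hne
  have hxB : x ∈ B := by
    have hyc := hB hy
    change Relation.ReflTransGen _ x y at hyc
    induction hyc with
    | refl => exact hy
    | tail h h' ih => exact ih (hcl _ hy _ h h'.1.symm)
  intro z hz
  change Relation.ReflTransGen _ x z at hz
  induction hz with
  | refl => exact hxB
  | tail h h' ih => exact hcl _ ih _ (compOn_closed h h'.2 h'.1) h'.1

lemma ConnOn.subset_compOn (hC : G.ConnOn C) (hCA : C ⊆ A) {x y : V} (hy : y ∈ C)
    (hyx : y ∈ G.compOn A x) : C ⊆ G.compOn A x :=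
  hC.subset_of hy hyx fun _ _ ha _ hz haz => compOn_closed ha (hCA hz) haz

lemma compOn_eq_of_mem {x y : V} (hx : x ∈ A) (hy : y ∈ G.compOn A x) :
    G.compOn A y = G.compOn A x := by
  have hyA := compOn_subset hx hy
  have h1 := (connOn_compOn (G := G) (A := A) y).subset_compOn (compOn_subset hyA)
    (mem_compOn_self y) hy
  refine h1.antisymm ?_
  exact (connOn_compOn (G := G) (A := A) x).subset_compOn (compOn_subset hx) hy (mem_compOn_self y)

lemma connOn_univ_of_connected (h : G.Connected) : G.ConnOn Set.univ := by
  obtain ⟨x⟩ := h.nonempty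
  refine connOn_of_subset (Set.mem_univ x) fun B _ hne hcl z hz => ?_
  clear hz
  obtain ⟨y, hy⟩ := hne
  obtain ⟨p⟩ := h.preconnected y z
  induction p with
  | nil => exact hy
  | cons hadj _ ih => exact ih (hcl _ hy _ trivial hadj)

lemma ConnOn.induce_connected (h : G.ConnOn A) : (G.induce A).Connected := by
  obtain ⟨x, hx⟩ := h.1
  have key : ∀ y (hy : y ∈ A), (G.induce A).Reachable ⟨x, hx⟩ ⟨y, hy⟩ := by
    have hsub : A ⊆ {y | ∃ hy : y ∈ A, (G.induce A).Reachable ⟨x, hx⟩ ⟨y, hy⟩} := by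
      refine h.subset_of hx ⟨hx, Reachable.refl _⟩ ?_
      rintro a _ ⟨ha, hr⟩ y hy hay
      exact ⟨hy, hr.trans (Adj.reachable (by simpa using hay))⟩
    intro y hy
    exact (hsub hy).2
  have : Nonempty A := ⟨⟨x, hx⟩⟩
  exact ⟨fun a b => (key a a.2).symm.trans (key b b.2)⟩

lemma connOn_of_induce_connected (h : (G.induce A).Connected) : G.ConnOn A := by
  obtain ⟨x⟩ := h.nonempty
  refine connOn_of_subset x.2 fun B hBA hne hcl => ?_
  have := (connOn_univ_of_connected h).subset_of (B := {z : A | (z : V) ∈ B})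
    (x := ⟨hne.some, hBA hne.some_mem⟩) trivial hne.some_mem
    (fun a _ ha y _ hay => hcl a ha y y.2 (by simpa using hay))
  intro z hz
  exact this (Set.mem_univ ⟨z, hz⟩)

/-- If adjacent vertices of a connected set are comparable in a forest order, then the set has a
topmost vertex. -/
lemma ConnOn.exists_top [Finite V] (hA : G.ConnOn A) (R : V → V → Prop)
    (hrefl : ∀ a ∈ A, R a a) (hanti : ∀ a b, R a b → R b a → a = b)
    (htrans : ∀ a b c, R a b → R b c → R a c)
    (hchain : ∀ a b d, R a d → R b d → R a b ∨ R b a)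
    (hadj : ∀ a ∈ A, ∀ b ∈ A, G.Adj a b → R a b ∨ R b a) :
    ∃ x ∈ A, ∀ y ∈ A, R x y := by
  classical
  obtain ⟨x, hxA, hmin⟩ := (Set.toFinite A).exists_minimalFor
    (fun a => {z | R z a}.ncard) A hA.1
  have hx : ∀ z ∈ A, R z x → z = x := by
    intro z hz hzx
    by_contra hne
    have hlt : {y | R y z}.ncard < {y | R y x}.ncard := by
      refine Set.ncard_lt_ncard ⟨fun y hy => htrans _ _ _ hy hzx, fun hsub => hne ?_⟩
      exact hanti _ _ hzx (hsub (hrefl x hxA))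
    exact absurd (hmin hz hlt.le) (not_le.mpr hlt)
  refine ⟨x, hxA, fun y hy => ?_⟩
  refine hA.subset_of (B := {y | R x y}) hxA (hrefl x hxA) ?_ hy
  intro a ha hxa z hz haz
  rcases hadj a ha z hz haz with h | h
  · exact htrans _ _ _ hxa h
  · rcases hchain x z a hxa h with h' | h'
    · exact h'
    · rw [hx z hz h']; exact hrefl x hxA

end ConnOn

/-! ### Recursive treedepth versus forest treedepth -/

section TdLE

variable {G : SimpleGraph V} {A B C : Set V} {n : ℕ}

lemma TdLE.mono_set (h : G.TdLE n A) (hB : B ⊆ A) : G.TdLE n B := by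
  cases n with
  | zero => exact Set.subset_eq_empty hB h
  | succ n => exact fun C hC => h C (hC.trans hB)

lemma TdLE.succ (h : G.TdLE n A) : G.TdLE (n + 1) A := by
  induction n generalizing A with
  | zero =>
    intro C hC hconn
    obtain ⟨x, hx⟩ := hconn.1
    have : x ∈ A := hC hx
    rw [show A = ∅ from h] at this
    exact this.elim
  | succ n ih =>
    intro C hC hconn
    obtain ⟨x, hx, h'⟩ := h C hC hconn
    exact ⟨x, hx, ih h'⟩

lemma TdLE.mono {m : ℕ} (h : G.TdLE n A) (hnm : n ≤ m) : G.TdLE m A := by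
  induction hnm with
  | refl => exact h
  | step _ ih => exact ih.succ

lemma tdLE_of_forall_connOn (h : ∀ C ⊆ A, G.ConnOn C → G.TdLE n C) : G.TdLE n A := by
  cases n with
  | zero =>
    refine Set.eq_empty_of_forall_notMem fun x hx => ?_
    have := h {x} (by simpa using hx) (connOn_singleton x)
    exact Set.singleton_ne_empty x this
  | succ n => exact fun C hC hconn => h C hC hconn C le_rfl hconn

lemma TdLE.of_diff_singleton {x : V} (h : G.TdLE n (A \ {x})) : G.TdLE (n + 1) A := by
  intro C hC hconn
  by_cases hx : x ∈ C
  · exact ⟨x, hx, h.mono_set (Set.sdiff_subset_sdiff_left hC)⟩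
  · obtain ⟨y, hy⟩ := hconn.1
    refine ⟨y, hy, h.mono_set fun z hz => ⟨hC hz.1, ?_⟩⟩
    rintro rfl
    exact hx hz.1

lemma tdLE_of_forall_compOn (h : ∀ x ∈ A, G.TdLE n (G.compOn A x)) : G.TdLE n A := by
  refine tdLE_of_forall_connOn fun C hC hconn => ?_
  obtain ⟨x, hx⟩ := hconn.1
  exact (h x (hC hx)).mono_set (hconn.subset_compOn hC hx (mem_compOn_self x))

/-- A single deleted vertex misses one of the two disjoint parts. This is the source of all
treedepth lower bounds for the subcubic tree. -/
lemma not_tdLE_succ_of_disjoint (hA : G.ConnOn A) (hB : B ⊆ A) (hC : C ⊆ A)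
    (hBC : Disjoint B C) (hnB : ¬ G.TdLE n B) (hnC : ¬ G.TdLE n C) : ¬ G.TdLE (n + 1) A := by
  intro h
  obtain ⟨x, _, hx⟩ := h A le_rfl hA
  by_cases hxB : x ∈ B
  · refine hnC (hx.mono_set fun z hz => ⟨hC hz, ?_⟩)
    rintro rfl
    exact Set.disjoint_left.mp hBC hxB hz
  · refine hnB (hx.mono_set fun z hz => ⟨hB hz, ?_⟩)
    rintro rfl
    exact hxB hz

lemma exists_tdLE [Finite V] (G : SimpleGraph V) (A : Set V) : G.TdLE A.ncard A := by
  induction h : A.ncard generalizing A with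
  | zero => exact (Set.ncard_eq_zero).mp h
  | succ n ih =>
    obtain ⟨x, hx⟩ : A.Nonempty := Set.nonempty_of_ncard_ne_zero (by omega)
    refine TdLE.of_diff_singleton (x := x) (ih _ ?_)
    have := Set.ncard_sdiff_singleton_add_one hx
    omega

/-- A vertex ranking with values below `n`, witnessing treedepth at most `n`. -/
lemma TdLE.exists_ranking (h : G.TdLE n A) : ∃ r : V → ℕ, (∀ x ∈ A, r x < n) ∧
    ∀ C ⊆ A, G.ConnOn C → ∀ a ∈ C, ∀ b ∈ C, r a = r b → (∀ c ∈ C, r c ≤ r a) → a = b := by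
  classical
  induction n generalizing A with
  | zero =>
    obtain rfl : A = ∅ := h
    exact ⟨fun _ => 0, by simp, fun C hC _ a ha => (hC ha).elim⟩
  | succ n ih =>
    rcases isEmpty_or_nonempty V with hV | hV
    · exact ⟨fun _ => 0, fun x => (hV.false x).elim, fun _ _ _ a => (hV.false a).elim⟩
    have hK : ∀ K : Set V, ∃ (x : V) (r : V → ℕ), K ⊆ A → G.ConnOn K →
        (∀ y ∈ K \ {x}, r y < n) ∧ ∀ C ⊆ K \ {x}, G.ConnOn C → ∀ a ∈ C, ∀ b ∈ C,
          r a = r b → (∀ c ∈ C, r c ≤ r a) → a = b := by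
      intro K
      by_cases hK : K ⊆ A ∧ G.ConnOn K
      · obtain ⟨x, hx, h'⟩ := h K hK.1 hK.2
        obtain ⟨r, hr⟩ := ih h'
        exact ⟨x, r, fun _ _ => hr⟩
      · exact ⟨hV.some, fun _ => 0, fun h1 h2 => absurd ⟨h1, h2⟩ hK⟩
    choose x r hxr using hK
    let K := fun v => G.compOn A v
    -- The vertex deleted from a component gets the top rank `n`; the others keep the rank from the
    -- recursion inside their component.
    refine ⟨fun v => if v = x (K v) then n else r (K v) v, ?_, ?_⟩
    · intro v hv
      have := (hxr (K v) (compOn_subset hv) (connOn_compOn v)).1 v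
      by_cases hvx : v = x (K v)
      · simp only [if_pos hvx]; omega
      · simp only [if_neg hvx]
        exact (this ⟨mem_compOn_self v, hvx⟩).trans (Nat.lt_succ_self n)
    · intro C hC hconn a ha b hb
      have haA := hC ha
      have hCK : C ⊆ K a := hconn.subset_compOn hC ha (mem_compOn_self a)
      have hKeq : ∀ c ∈ C, K c = K a := fun c hc => compOn_eq_of_mem haA (hCK hc)
      obtain ⟨h1, h2⟩ := hxr (K a) (compOn_subset haA) (connOn_compOn a)
      intro hab hmax
      beta_reduce at hab hmax
      by_cases hx : x (K a) ∈ C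
      · have hge : ∀ c ∈ C, n ≤ (if c = x (K c) then n else r (K c) c) → c = x (K a) := by
          intro c hc hn
          by_contra hne
          rw [hKeq c hc, if_neg hne] at hn
          exact absurd (h1 c ⟨hCK hc, hne⟩) (not_lt.mpr hn)
        have hxm := hmax _ hx
        simp only [hKeq _ hx, if_true] at hxm
        rw [hge a ha hxm, hge b hb (hxm.trans hab.le)]
      · have hne : ∀ c ∈ C, c ≠ x (K a) := by
          rintro c hc rfl
          exact hx hc
        have hval : ∀ c ∈ C, (if c = x (K c) then n else r (K c) c) = r (K a) c := by
          intro c hc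
          rw [hKeq c hc, if_neg (hne c hc)]
        rw [hval a ha] at hab hmax
        rw [hval b hb] at hab
        exact h2 C (fun c hc => ⟨hCK hc, hne c hc⟩) hconn a ha b hb hab
          fun c hc => (hval c hc) ▸ hmax c hc

/-- The rooted forest of a vertex ranking. -/
def forestOfRanking (G : SimpleGraph V) (r : V → ℕ)
    (hr : ∀ C, G.ConnOn C → ∀ a ∈ C, ∀ b ∈ C, r a = r b → (∀ c ∈ C, r c ≤ r a) → a = b) :
    RootedForest V where
  anc a d := ∃ C, G.ConnOn C ∧ a ∈ C ∧ d ∈ C ∧ ∀ c ∈ C, r c ≤ r a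
  anc_refl a := ⟨{a}, connOn_singleton a, rfl, rfl, by simp⟩
  anc_antisymm := by
    rintro a b ⟨C, hC, ha, hb, hm⟩ ⟨C', -, ha', hb', hm'⟩
    exact hr C hC a ha b hb (le_antisymm (hm' _ hb') (hm _ hb)) hm
  anc_trans := by
    rintro a b c ⟨C, hC, ha, hb, hm⟩ ⟨C', hC', hb', hc', hm'⟩
    refine ⟨C ∪ C', hC.union hC' ⟨b, hb, hb'⟩, Or.inl ha, Or.inr hc', ?_⟩
    rintro x (hx | hx)
    · exact hm x hx
    · exact (hm' x hx).trans (hm b hb)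
  anc_chain := by
    rintro a b d ⟨C, hC, ha, hd, hm⟩ ⟨C', hC', hb', hd', hm'⟩
    have hU := hC.union hC' ⟨d, hd, hd'⟩
    rcases le_total (r a) (r b) with h | h
    · refine Or.inr ⟨C ∪ C', hU, Or.inr hb', Or.inl ha, ?_⟩
      rintro x (hx | hx)
      · exact (hm x hx).trans h
      · exact hm' x hx
    · refine Or.inl ⟨C ∪ C', hU, Or.inl ha, Or.inr hb', ?_⟩
      rintro x (hx | hx)
      · exact hm x hx
      · exact (hm' x hx).trans h

lemma TdLE.exists_decomposition [Finite V] (h : G.TdLE n Set.univ) :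
    ∃ F : RootedForest V, G.IsTreedepthDecomposition F id ∧ F.height ≤ n := by
  obtain ⟨r, hlt, hr⟩ := h.exists_ranking
  refine ⟨G.forestOfRanking r fun C => hr C (Set.subset_univ C), ⟨Function.injective_id, ?_⟩, ?_⟩
  · intro x y hxy
    have hc : G.ConnOn ({x} ∪ {y}) := (connOn_singleton x).join (connOn_singleton y) rfl rfl hxy
    rcases le_total (r x) (r y) with h | h
    · refine Or.inr ⟨_, hc, Or.inr rfl, Or.inl rfl, ?_⟩
      rintro c (rfl | rfl)
      exacts [h, le_rfl]
    · refine Or.inl ⟨_, hc, Or.inl rfl, Or.inr rfl, ?_⟩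
      rintro c (rfl | rfl)
      exacts [le_rfl, h]
  · refine ciSup_le' fun d => ?_
    have := Set.ncard_le_ncard_of_injOn (t := Set.Iio n) (s := {a | (G.forestOfRanking r
      fun C => hr C (Set.subset_univ C)).anc a d}) r (fun a _ => hlt a trivial) ?_
      (Set.finite_Iio n)
    · simpa using this
    · intro a ha b hb hab
      rcases (G.forestOfRanking r fun C => hr C (Set.subset_univ C)).anc_chain a b d ha hb
        with ⟨C, hC, h1, h2, h3⟩ | ⟨C, hC, h1, h2, h3⟩
      · exact hr C (Set.subset_univ C) hC a h1 b h2 hab h3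
      · exact (hr C (Set.subset_univ C) hC b h1 a h2 hab.symm h3).symm

lemma TdLE.treedepth_le [Finite V] (h : G.TdLE n Set.univ) : G.treedepth ≤ n := by
  obtain ⟨F, hF, hn⟩ := h.exists_decomposition
  refine le_trans (Nat.sInf_le ?_) hn
  exact ⟨V, inferInstance, F, id, hF, rfl⟩

lemma exists_decomposition_treedepth [Finite V] (G : SimpleGraph V) :
    ∃ (W : Type u) (_ : Finite W) (F : RootedForest W) (f : V → W),
      G.IsTreedepthDecomposition F f ∧ F.height = G.treedepth := by
  obtain ⟨F, hF, -⟩ := (exists_tdLE G Set.univ).exists_decomposition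
  exact Nat.sInf_mem (s := {k : ℕ | ∃ (W : Type u) (_ : Finite W) (F : RootedForest W)
    (f : V → W), G.IsTreedepthDecomposition F f ∧ F.height = k})
    ⟨_, V, inferInstance, F, id, hF, rfl⟩

/-- A forest order in which adjacent vertices are comparable bounds the treedepth. -/
lemma tdLE_of_forest_order [Finite V] (R : V → V → Prop)
    (hrefl : ∀ a ∈ A, R a a) (hanti : ∀ a b, R a b → R b a → a = b)
    (htrans : ∀ a b c, R a b → R b c → R a c)
    (hchain : ∀ a b d, R a d → R b d → R a b ∨ R b a)
    (hadj : ∀ a ∈ A, ∀ b ∈ A, G.Adj a b → R a b ∨ R b a)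
    (hn : ∀ d ∈ A, {a | a ∈ A ∧ R a d}.ncard ≤ n) : G.TdLE n A := by
  induction n generalizing A with
  | zero =>
    refine Set.eq_empty_of_forall_notMem fun x hx => ?_
    have h0 := (Set.ncard_eq_zero).mp (Nat.le_zero.mp (hn x hx))
    have : x ∈ {a | a ∈ A ∧ R a x} := ⟨hx, hrefl x hx⟩
    rw [h0] at this
    exact this
  | succ n ih =>
    intro C hC hconn
    obtain ⟨x, hx, htop⟩ := hconn.exists_top R (fun a ha => hrefl a (hC ha)) hanti htrans hchain
      fun a ha b hb => hadj a (hC ha) b (hC hb)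
    refine ⟨x, hx, ih (fun a ha => hrefl a (hC ha.1))
      (fun a ha b hb => hadj a (hC ha.1) b (hC hb.1)) fun d hd => ?_⟩
    have hlt : {a | a ∈ C \ {x} ∧ R a d}.ncard < {a | a ∈ A ∧ R a d}.ncard := by
      refine Set.ncard_lt_ncard ⟨fun a ha => ⟨hC ha.1.1, ha.2⟩, fun hsub => ?_⟩
      exact (hsub (a := x) ⟨hC hx, htop d hd.1⟩).1.2 rfl
    have := hn d (hC hd.1)
    omega

/-- The forest order of an optimal decomposition is pulled back to `A`; this converts failure of
`TdLE` into a lower bound on `treedepth`. -/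
lemma tdLE_treedepth_induce [Finite V] (G : SimpleGraph V) (A : Set V) :
    G.TdLE (G.induce A).treedepth A := by
  obtain ⟨W, _, F, f, ⟨hinj, hadj⟩, hF⟩ := exists_decomposition_treedepth (G.induce A)
  rw [← hF]
  refine tdLE_of_forest_order
    (fun a b => ∃ (ha : a ∈ A) (hb : b ∈ A), F.anc (f ⟨a, ha⟩) (f ⟨b, hb⟩))
    (fun a ha => ⟨ha, ha, F.anc_refl _⟩) ?_ ?_ ?_ ?_ ?_
  · rintro a b ⟨ha, hb, h⟩ ⟨_, _, h'⟩
    simpa using hinj (F.anc_antisymm _ _ h h')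
  · rintro a b c ⟨ha, hb, h⟩ ⟨_, hc, h'⟩
    exact ⟨ha, hc, F.anc_trans _ _ _ h h'⟩
  · rintro a b d ⟨ha, hd, h⟩ ⟨hb, _, h'⟩
    exact (F.anc_chain _ _ _ h h').imp (fun h => ⟨ha, hb, h⟩) fun h => ⟨hb, ha, h⟩
  · intro a ha b hb hab
    exact (hadj ⟨a, ha⟩ ⟨b, hb⟩ (by simpa using hab)).imp (fun h => ⟨ha, hb, h⟩)
      fun h => ⟨hb, ha, h⟩
  · intro d hd
    refine le_trans ?_ (le_ciSup (f := fun d : W => {a : W | F.anc a d}.ncard)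
      (Set.toFinite _).bddAbove (f ⟨d, hd⟩))
    classical
    refine Set.ncard_le_ncard_of_injOn (fun a => if ha : a ∈ A then f ⟨a, ha⟩ else f ⟨d, hd⟩) ?_ ?_
      (Set.toFinite _)
    · rintro a ⟨ha, _, _, h⟩
      simpa [ha] using h
    · rintro a ⟨ha, _⟩ b ⟨hb, _⟩ hab
      simp only [ha, hb, dif_pos] at hab
      simpa using hinj hab

end TdLE

end SimpleGraph

namespace SimpleGraph

/-! ### Splitting trees along edges -/

variable {V : Type u} {S : SimpleGraph V} {A B C : Set V}

/-- The set `A` is the disjoint union of the connected sets `A₁ ∋ u` and `A₂ ∋ w`, and `u w` is the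
only edge between them. -/
structure IsSplit (S : SimpleGraph V) (A A₁ A₂ : Set V) (u w : V) : Prop where
  left_mem : u ∈ A₁
  right_mem : w ∈ A₂
  adj : S.Adj u w
  connOn_left : S.ConnOn A₁
  connOn_right : S.ConnOn A₂
  union_eq : A₁ ∪ A₂ = A
  disjoint : Disjoint A₁ A₂
  eq_of_adj : ∀ x ∈ A₁, ∀ y ∈ A₂, S.Adj x y → x = u ∧ y = w

namespace IsSplit

variable {A₁ A₂ : Set V} {u w : V}

lemma symm (h : S.IsSplit A A₁ A₂ u w) : S.IsSplit A A₂ A₁ w u where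
  left_mem := h.right_mem
  right_mem := h.left_mem
  adj := h.adj.symm
  connOn_left := h.connOn_right
  connOn_right := h.connOn_left
  union_eq := by rw [Set.union_comm]; exact h.union_eq
  disjoint := h.disjoint.symm
  eq_of_adj x hx y hy hxy := (h.eq_of_adj y hy x hx hxy.symm).symm

lemma left_subset (h : S.IsSplit A A₁ A₂ u w) : A₁ ⊆ A := h.union_eq ▸ Set.subset_union_left

lemma right_subset (h : S.IsSplit A A₁ A₂ u w) : A₂ ⊆ A := h.symm.left_subset

lemma notMem_right (h : S.IsSplit A A₁ A₂ u w) {x : V} (hx : x ∈ A₁) : x ∉ A₂ :=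
  Set.disjoint_left.mp h.disjoint hx

lemma notMem_left (h : S.IsSplit A A₁ A₂ u w) {x : V} (hx : x ∈ A₂) : x ∉ A₁ :=
  h.symm.notMem_right hx

lemma mem_or (h : S.IsSplit A A₁ A₂ u w) {x : V} (hx : x ∈ A) : x ∈ A₁ ∨ x ∈ A₂ := by
  rwa [← h.union_eq] at hx

/-- A connected set avoiding one end of the edge lies on one side. -/
lemma subset_right (h : S.IsSplit A A₁ A₂ u w) (hC : S.ConnOn C) (hCA : C ⊆ A) (hu : u ∉ C)
    {x : V} (hx : x ∈ C) (hx₂ : x ∈ A₂) : C ⊆ A₂ := by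
  refine hC.subset_of hx hx₂ fun a ha ha₂ y hy hay => ?_
  refine (h.mem_or (hCA hy)).resolve_left fun hy₁ => ?_
  exact hu ((h.eq_of_adj y hy₁ a ha₂ hay.symm).1 ▸ hy)

end IsSplit

/-- Every edge of a forest is a bridge, so the sides are the components of its two ends once the
edge is deleted. -/
lemma exists_isSplit (hS : S.IsAcyclic) (hA : S.ConnOn A) {u w : V} (hu : u ∈ A) (hw : w ∈ A)
    (huw : S.Adj u w) : ∃ A₁ A₂, S.IsSplit A A₁ A₂ u w := by
  set S' := S \ fromEdgeSet {s(u, w)} with hS'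
  have hbr : ¬ S'.Reachable u w := (isAcyclic_iff_forall_adj_isBridge.mp hS huw)
  have hle : S' ≤ S := sdiff_le
  have hreach : ∀ x y, y ∈ S'.compOn A x → S'.Reachable x y := by
    intro x y hy
    change Relation.ReflTransGen _ x y at hy
    induction hy with
    | refl => exact Reachable.refl _
    | tail _ h ih => exact ih.trans h.1.reachable
  have hdis : ∀ y, y ∈ S'.compOn A u → y ∉ S'.compOn A w := fun y h1 h2 =>
    hbr ((hreach _ _ h1).trans (hreach _ _ h2).symm)
  have hadj : ∀ x y, S.Adj x y → S'.Adj x y ∨ s(x, y) = s(u, w) := by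
    intro x y hxy
    by_cases he : s(x, y) = s(u, w)
    · exact Or.inr he
    · refine Or.inl ⟨hxy, fun h => he ?_⟩
      simpa using h.1
  refine ⟨S'.compOn A u, S'.compOn A w, mem_compOn_self u, mem_compOn_self w, huw,
    (connOn_compOn u).mono_graph hle, (connOn_compOn w).mono_graph hle, ?_,
    Set.disjoint_left.mpr hdis, ?_⟩
  · refine Set.Subset.antisymm (Set.union_subset (compOn_subset hu) (compOn_subset hw)) ?_
    refine hA.subset_of hu (Or.inl (mem_compOn_self u)) fun a _ ha y hy hay => ?_
    rcases hadj a y hay with h | h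
    · exact ha.imp (fun ha => compOn_closed ha hy h) fun ha => compOn_closed ha hy h
    · rcases Sym2.eq_iff.mp h with ⟨-, rfl⟩ | ⟨-, rfl⟩
      · exact Or.inr (mem_compOn_self _)
      · exact Or.inl (mem_compOn_self _)
  · intro x hx y hy hxy
    rcases hadj x y hxy with h | h
    · exact absurd hy (hdis y (compOn_closed hx (compOn_subset hw hy) h))
    · rcases Sym2.eq_iff.mp h with h | ⟨rfl, rfl⟩
      · exact h
      · exact absurd (mem_compOn_self _) (hdis _ hx)

/-- Two neighbours of `x` in a connected set avoiding `x` coincide. -/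
lemma ConnOn.eq_of_adj (hS : S.IsAcyclic) (hC : S.ConnOn C) {x y z : V} (hx : x ∉ C) (hy : y ∈ C)
    (hz : z ∈ C) (hxy : S.Adj x y) (hxz : S.Adj x z) : y = z := by
  obtain ⟨B₁, B₂, h⟩ := exists_isSplit hS (hC.join (connOn_singleton x) hy rfl hxy.symm)
    (u := x) (w := y) (Or.inr rfl) (Or.inl hy) hxy
  have := h.subset_right hC Set.subset_union_left hx hy h.right_mem
  exact (h.eq_of_adj x h.left_mem z (this hz) hxz).2.symm

lemma exists_isSplit_of_notMem (hS : S.IsAcyclic) (hA : S.ConnOn A) {w : V} (hw : w ∈ A)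
    (hC : S.ConnOn C) (hCA : C ⊆ A) (hwC : w ∉ C) :
    ∃ z B₁ B₂, S.IsSplit A B₁ B₂ w z ∧ C ⊆ B₂ := by
  obtain ⟨c, hc⟩ := hC.1
  have hcw : c ∈ A \ {w} := ⟨hCA hc, fun h => hwC (Set.mem_singleton_iff.mp h ▸ hc)⟩
  have hK := connOn_compOn (G := S) (A := A \ {w}) c
  have hKs := compOn_subset (G := S) hcw
  have hCw : C ⊆ A \ {w} := fun x hx => ⟨hCA hx, fun h => hwC (Set.mem_singleton_iff.mp h ▸ hx)⟩
  have hCK : C ⊆ S.compOn (A \ {w}) c := hC.subset_compOn hCw hc (mem_compOn_self c)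
  obtain ⟨z, hz, y, hyA, hy, hzy⟩ := hA.exists_adj (hKs.trans Set.sdiff_subset) hK.1
    (fun h => (hKs (h.symm.subset hw)).2 rfl)
  obtain rfl : y = w := by
    by_contra hne
    exact hy (compOn_closed hz ⟨hyA, hne⟩ hzy)
  obtain ⟨B₁, B₂, h⟩ := exists_isSplit hS hA hyA (hKs hz).1 hzy.symm
  exact ⟨z, B₁, B₂, h, hCK.trans
    (h.subset_right hK (hKs.trans Set.sdiff_subset) hy hz h.right_mem)⟩

/-- In a tree, a monotone notion of large sets either has a centroid or an edge with both sides
large. -/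
lemma ConnOn.exists_centroid_or_isSplit [Finite V] (hS : S.IsAcyclic) (hA : S.ConnOn A)
    (H : Set V → Prop) (hH : ∀ B C, B ⊆ C → H B → H C) :
    (∃ x ∈ A, ∀ C ⊆ A \ {x}, S.ConnOn C → ¬ H C) ∨
      ∃ A₁ A₂ u w, S.IsSplit A A₁ A₂ u w ∧ H A₁ ∧ H A₂ := by
  rw [or_iff_not_imp_left]
  intro hno
  push Not at hno
  have hstep : ∀ x ∈ A, ∃ C z B₁ B₂, C ⊆ A ∧ x ∉ C ∧ S.ConnOn C ∧ H C ∧ S.IsSplit A B₁ B₂ x z ∧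
      C ⊆ B₂ := by
    intro x hx
    obtain ⟨C, hCA, hC, hHC⟩ := hno x hx
    have hxC : x ∉ C := fun h => (hCA h).2 rfl
    obtain ⟨z, B₁, B₂, h, hCB⟩ := exists_isSplit_of_notMem hS hA hx hC
      (hCA.trans Set.sdiff_subset) hxC
    exact ⟨C, z, B₁, B₂, hCA.trans Set.sdiff_subset, hxC, hC, hHC, h, hCB⟩
  have hne : {B₂ | ∃ B₁ u w, S.IsSplit A B₁ B₂ u w ∧ H B₂}.Nonempty := by
    obtain ⟨x, hx⟩ := hA.1
    obtain ⟨C, z, B₁, B₂, -, -, -, hHC, h, hCB⟩ := hstep x hx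
    exact ⟨B₂, B₁, x, z, h, hH _ _ hCB hHC⟩
  -- Take a smallest large side `A₂`, with end `w`. A large connected set avoiding `w` lies either
  -- in `A₁`, making both sides large, or beyond an edge at `w` inside `A₂`, giving a smaller large
  -- side.
  obtain ⟨A₂, ⟨A₁, u, w, h, hH₂⟩, hmin⟩ := (Set.toFinite _).exists_minimalFor
    (fun B : Set V => B.ncard) _ hne
  obtain ⟨C, z, B₁, B₂, hCA, hwC, hC, hHC, hB, hCB⟩ := hstep w (h.right_subset h.right_mem)
  obtain ⟨c, hc⟩ := hC.1
  rcases h.mem_or (hCA hc) with hc₁ | hc₂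
  · exact ⟨A₁, A₂, u, w, h, hH _ _ (h.symm.subset_right hC hCA hwC hc hc₁) hHC, hH₂⟩
  · exfalso
    have hwB : w ∉ B₂ := hB.notMem_right hB.left_mem
    have hsub : B₂ ⊆ A₂ := by
      refine hB.connOn_right.subset_of (hCB hc) hc₂ fun a ha ha₂ y hy hay => ?_
      refine (h.mem_or (hB.right_subset hy)).resolve_left fun hy₁ => ?_
      exact hwB ((h.eq_of_adj y hy₁ a ha₂ hay.symm).2 ▸ ha)
    have hlt : B₂.ncard < A₂.ncard :=
      Set.ncard_lt_ncard ⟨hsub, fun h' => hwB (h' h.right_mem)⟩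
    exact absurd (hmin ⟨B₁, w, z, hB, hH _ _ hCB hHC⟩ hlt.le) (not_le.mpr hlt)

/-- If there were a centroid for "treedepth above `n`", deleting it would give treedepth at most `n
+ 1`. -/
lemma ConnOn.exists_isSplit_of_not_tdLE [Finite V] (hS : S.IsAcyclic) (hA : S.ConnOn A) {n : ℕ}
    (h : ¬ S.TdLE (n + 1) A) :
    ∃ A₁ A₂ u w, S.IsSplit A A₁ A₂ u w ∧ ¬ S.TdLE n A₁ ∧ ¬ S.TdLE n A₂ := by
  refine (hA.exists_centroid_or_isSplit hS (fun B => ¬ S.TdLE n B)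
    fun B C hBC hB hC => hB (hC.mono_set hBC)).resolve_left ?_
  rintro ⟨x, -, hx⟩
  refine h (TdLE.of_diff_singleton (x := x) (tdLE_of_forall_connOn fun C hC hconn => ?_))
  exact not_not.mp (hx C hC hconn)

/-- A minimal connected set containing `M` has degrees bounded in terms of `M`. -/
lemma ConnOn.exists_steiner [Finite V] [DecidableEq V] (hS : S.IsAcyclic) (hA : S.ConnOn A)
    (M : Finset V) (hM : (M : Set V) ⊆ A) :
    ∃ Y ⊆ A, S.ConnOn Y ∧ (M : Set V) ⊆ Y ∧
      ∀ x ∈ Y, (S.neighborSet x ∩ Y).ncard ≤ (M \ {x}).card := by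
  obtain ⟨Y, ⟨hYA, hY, hMY⟩, hmin⟩ := (Set.toFinite _).exists_minimalFor
    (fun B : Set V => B.ncard) {Y | Y ⊆ A ∧ S.ConnOn Y ∧ (M : Set V) ⊆ Y} ⟨A, le_rfl, hA, hM⟩
  refine ⟨Y, hYA, hY, hMY, fun x hx => ?_⟩
  -- By minimality of `Y`, the branch at each neighbour `y` of `x` contains a terminal. Distinct
  -- neighbours have disjoint branches, so these terminals are distinct, and none is `x`.
  have hside : ∀ y, ∃ B₁ B₂ m, y ∈ S.neighborSet x ∩ Y →
      S.IsSplit Y B₁ B₂ x y ∧ m ∈ M ∧ m ∈ B₂ := by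
    intro y
    by_cases hy : y ∈ S.neighborSet x ∩ Y
    · obtain ⟨B₁, B₂, h⟩ := exists_isSplit hS hY hx hy.2 hy.1
      have : ∃ m ∈ M, m ∈ B₂ := by
        by_contra! hcon
        have hlt : B₁.ncard < Y.ncard := Set.ncard_lt_ncard
          ⟨h.left_subset, fun h' => h.notMem_left h.right_mem (h' hy.2)⟩
        exact absurd (hmin ⟨h.left_subset.trans hYA, h.connOn_left,
          fun m hm => (h.mem_or (hMY hm)).resolve_right (hcon m hm)⟩ hlt.le) (not_le.mpr hlt)
      obtain ⟨m, hm, hmB⟩ := this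
      exact ⟨B₁, B₂, m, fun _ => ⟨h, hm, hmB⟩⟩
    · exact ⟨∅, ∅, x, fun h => absurd h hy⟩
  choose B₁ B₂ m hB using hside
  rw [← Set.ncard_coe_finset]
  refine Set.ncard_le_ncard_of_injOn m ?_ ?_ (Set.toFinite _)
  · intro y hy
    obtain ⟨h, hm, hmB⟩ := hB y hy
    have : m y ≠ x := fun he => h.notMem_right h.left_mem (he ▸ hmB)
    simpa using ⟨hm, this⟩
  · intro y hy y' hy' he
    obtain ⟨h, -, hmB⟩ := hB y hy
    obtain ⟨h', -, hmB'⟩ := hB y' hy'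
    have hsub := h.subset_right h'.connOn_right h'.right_subset (h'.notMem_right h'.left_mem)
      hmB' (he ▸ hmB)
    exact (h.eq_of_adj x h.left_mem y' (hsub h'.right_mem) hy'.1).2.symm

end SimpleGraph

namespace SimpleGraph

/-! ### Subcubic subtrees of large treedepth -/

variable {V : Type u} {S : SimpleGraph V} {A B C : Set V}

lemma ncard_neighborSet_inter_union_le [Finite V] [DecidableEq V] {A₁ A₂ X₁ X₂ : Set V} {u w : V}
    (h : S.IsSplit A A₁ A₂ u w) (hX₁ : X₁ ⊆ A₁) (hX₂ : X₂ ⊆ A₂) {x : V} (hx : x ∈ X₁) :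
    (S.neighborSet x ∩ (X₁ ∪ X₂)).ncard ≤
      (S.neighborSet x ∩ X₁).ncard + if x = u then 1 else 0 := by
  rw [Set.inter_union_distrib_left]
  refine (Set.ncard_union_le _ _).trans (Nat.add_le_add_left ?_ _)
  split_ifs with hxu
  · refine (Set.ncard_le_ncard (t := {w}) ?_).trans (Set.ncard_singleton w).le
    rintro y ⟨hy, hyX⟩
    exact (h.eq_of_adj x (hX₁ hx) y (hX₂ hyX) hy).2
  · rw [Nat.le_zero, Set.ncard_eq_zero, Set.eq_empty_iff_forall_notMem]
    rintro y ⟨hy, hyX⟩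
    exact hxu (h.eq_of_adj x (hX₁ hx) y (hX₂ hyX) hy).1

/-- Degree budget of a Steiner tree on three terminals: each terminal equal to `x` lowers the degree
bound at `x` by one, which leaves room for a further edge or mark there. -/
lemma card_sdiff_le_three {α : Type*} [DecidableEq α] (v b u x : α) :
    (({v, b, u} : Finset α) \ {x}).card + (if x = u then 1 else 0) + (if x = v then 1 else 0)
      + (if x = b then 1 else 0) ≤ 3 := by
  have h : (({v, b, u} : Finset α) \ {x}).card ≤
      (if x = u then 0 else 1) + (if x = v then 0 else 1) + (if x = b then 0 else 1) := by
    have hsub : (({v, b, u} : Finset α) \ {x}) ⊆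
        (({u} : Finset α) \ {x}) ∪ (({v} : Finset α) \ {x}) ∪ (({b} : Finset α) \ {x}) := by
      intro y
      simp only [Finset.mem_sdiff, Finset.mem_insert, Finset.mem_singleton, Finset.mem_union]
      tauto
    have hone : ∀ z : α, (({z} : Finset α) \ {x}).card ≤ if x = z then 0 else 1 := by
      intro z
      split_ifs with hz
      · simp [hz]
      · exact (Finset.card_le_card Finset.sdiff_subset).trans (by simp)
    calc _ ≤ _ := Finset.card_le_card hsub
      _ ≤ _ := Finset.card_union_le _ _
      _ ≤ _ := Nat.add_le_add_right (Finset.card_union_le _ _) _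
      _ ≤ _ := Nat.add_le_add (Nat.add_le_add (hone u) (hone v)) (hone b)
  split_ifs at h ⊢ <;> omega

/-- Large treedepth of a tree yields a subcubic subtree of large treedepth that contains one
prescribed vertex with degree at most two, or two prescribed vertices. -/
lemma exists_subcubic_marked [Finite V] [DecidableEq V] (hS : S.IsAcyclic) (k : ℕ) :
    (∀ A v, S.ConnOn A → v ∈ A → ¬ S.TdLE (2 * k) A → ∃ X ⊆ A, S.ConnOn X ∧ v ∈ X ∧
      (∀ x ∈ X, (S.neighborSet x ∩ X).ncard + (if x = v then 1 else 0) ≤ 3) ∧ ¬ S.TdLE k X) ∧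
    (∀ A v b, S.ConnOn A → v ∈ A → b ∈ A → ¬ S.TdLE (2 * k + 1) A →
      ∃ X ⊆ A, S.ConnOn X ∧ v ∈ X ∧ b ∈ X ∧ (∀ x ∈ X, (S.neighborSet x ∩ X).ncard
        + (if x = v then 1 else 0) + (if x = b then 1 else 0) ≤ 3) ∧ ¬ S.TdLE k X) := by
  induction k with
  | zero =>
    have key : ∀ A v b, S.ConnOn A → v ∈ A → b ∈ A →
      ∃ X ⊆ A, S.ConnOn X ∧ v ∈ X ∧ b ∈ X ∧ (∀ x ∈ X, (S.neighborSet x ∩ X).ncard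
        + (if x = v then 1 else 0) + (if x = b then 1 else 0) ≤ 3) ∧ ¬ S.TdLE 0 X := by
      intro A v b hA hv hb
      -- The repeated `b` fits the three-terminal budget of `card_sdiff_le_three`.
      obtain ⟨Y, hYA, hY, hMY, hdeg⟩ := hA.exists_steiner hS {v, b, b} (by
        intro z hz
        simp only [Finset.coe_insert, Finset.coe_singleton, Set.mem_insert_iff,
          Set.mem_singleton_iff, or_self] at hz
        rcases hz with rfl | rfl <;> assumption)
      refine ⟨Y, hYA, hY, hMY (by simp), hMY (by simp), fun x hx => ?_, hY.1.ne_empty⟩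
      have h1 := hdeg x hx
      have h2 := card_sdiff_le_three v b b x
      omega
    refine ⟨fun A v hA hv _ => ?_, fun A v b hA hv hb _ => key A v b hA hv hb⟩
    obtain ⟨X, hXA, hX, hvX, -, hdeg, h⟩ := key A v v hA hv hv
    exact ⟨X, hXA, hX, hvX, fun x hx => le_trans (Nat.le_add_right _ _) (hdeg x hx), h⟩
  | succ k ih =>
    obtain ⟨ihU, ihR⟩ := ih
    have hU : ∀ A v, S.ConnOn A → v ∈ A → ¬ S.TdLE (2 * (k + 1)) A → ∃ X ⊆ A, S.ConnOn X ∧ v ∈ X ∧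
      (∀ x ∈ X, (S.neighborSet x ∩ X).ncard + (if x = v then 1 else 0) ≤ 3) ∧
        ¬ S.TdLE (k + 1) X := by
      intro A v hA hv htd
      obtain ⟨A₁, A₂, u, w, h, h₁, h₂⟩ := hA.exists_isSplit_of_not_tdLE hS (n := 2 * k + 1) htd
      wlog hv₁ : v ∈ A₁ generalizing A₁ A₂ u w
      · exact this A₂ A₁ w u h.symm h₂ h₁ ((h.mem_or hv).resolve_left hv₁)
      -- The side of `v` must reserve degree at both `v` and `u`, the other side only at `w`; hence
      -- the thresholds `2k + 1` and `2k`.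
      obtain ⟨X₁, hX₁A, hX₁, hvX, huX, hdeg₁, htd₁⟩ := ihR A₁ v u h.connOn_left hv₁ h.left_mem h₁
      obtain ⟨X₂, hX₂A, hX₂, hwX, hdeg₂, htd₂⟩ := ihU A₂ w h.connOn_right h.right_mem
        fun h' => h₂ h'.succ
      refine ⟨X₁ ∪ X₂, Set.union_subset (hX₁A.trans h.left_subset) (hX₂A.trans h.right_subset),
        hX₁.join hX₂ huX hwX h.adj, Or.inl hvX, ?_,
        not_tdLE_succ_of_disjoint (hX₁.join hX₂ huX hwX h.adj) Set.subset_union_left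
          Set.subset_union_right (h.disjoint.mono hX₁A hX₂A) htd₁ htd₂⟩
      rintro x (hx | hx)
      · have h1 := ncard_neighborSet_inter_union_le h hX₁A hX₂A hx
        have h2 := hdeg₁ x hx
        omega
      · have h1 := ncard_neighborSet_inter_union_le h.symm hX₂A hX₁A hx
        have h2 := hdeg₂ x hx
        rw [Set.union_comm, if_neg (show x ≠ v from fun he => h.notMem_right hv₁ (he ▸ hX₂A hx))]
        omega
    refine ⟨hU, fun A v b hA hv hb htd => ?_⟩
    obtain ⟨A₁, A₂, u, w, h, h₁, h₂⟩ := hA.exists_isSplit_of_not_tdLE hS (n := 2 * (k + 1)) htd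
    wlog hv₁ : v ∈ A₁ generalizing A₁ A₂ u w
    · exact this A₂ A₁ w u h.symm h₂ h₁ ((h.mem_or hv).resolve_left hv₁)
    rcases h.mem_or hb with hb₁ | hb₂
    · obtain ⟨Y, hYA, hY, hMY, hdeg₁⟩ := h.connOn_left.exists_steiner hS {v, b, u} (by
        intro z hz
        simp only [Finset.coe_insert, Finset.coe_singleton, Set.mem_insert_iff,
          Set.mem_singleton_iff] at hz
        rcases hz with rfl | rfl | rfl
        exacts [hv₁, hb₁, h.left_mem])
      obtain ⟨X₂, hX₂A, hX₂, hwX, hdeg₂, htd₂⟩ := hU A₂ w h.connOn_right h.right_mem h₂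
      refine ⟨Y ∪ X₂, Set.union_subset (hYA.trans h.left_subset) (hX₂A.trans h.right_subset),
        hY.join hX₂ (hMY (by simp)) hwX h.adj, Or.inl (hMY (by simp)), Or.inl (hMY (by simp)), ?_,
        fun h' => htd₂ (h'.mono_set Set.subset_union_right)⟩
      rintro x (hx | hx)
      · have h1 := ncard_neighborSet_inter_union_le h hYA hX₂A hx
        have h2 := hdeg₁ x hx
        have h3 := card_sdiff_le_three v b u x
        omega
      · have h1 := ncard_neighborSet_inter_union_le h.symm hX₂A hYA hx
        have h2 := hdeg₂ x hx
        rw [Set.union_comm, if_neg (show x ≠ v from fun he => h.notMem_right hv₁ (he ▸ hX₂A hx)),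
          if_neg (show x ≠ b from fun he => h.notMem_right hb₁ (he ▸ hX₂A hx))]
        omega
    · obtain ⟨X₁, hX₁A, hX₁, hvX, huX, hdeg₁, htd₁⟩ := ihR A₁ v u h.connOn_left hv₁ h.left_mem
        fun h' => h₁ h'.succ
      obtain ⟨X₂, hX₂A, hX₂, hwX, hbX, hdeg₂, htd₂⟩ := ihR A₂ w b h.connOn_right h.right_mem hb₂
        fun h' => h₂ h'.succ
      refine ⟨X₁ ∪ X₂, Set.union_subset (hX₁A.trans h.left_subset) (hX₂A.trans h.right_subset),
        hX₁.join hX₂ huX hwX h.adj, Or.inl hvX, Or.inr hbX, ?_,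
        not_tdLE_succ_of_disjoint (hX₁.join hX₂ huX hwX h.adj) Set.subset_union_left
          Set.subset_union_right (h.disjoint.mono hX₁A hX₂A) htd₁ htd₂⟩
      rintro x (hx | hx)
      · have h1 := ncard_neighborSet_inter_union_le h hX₁A hX₂A hx
        have h2 := hdeg₁ x hx
        rw [if_neg (show x ≠ b from fun he => h.notMem_left hb₂ (he ▸ hX₁A hx))]
        omega
      · have h1 := ncard_neighborSet_inter_union_le h.symm hX₂A hX₁A hx
        have h2 := hdeg₂ x hx
        rw [Set.union_comm, if_neg (show x ≠ v from fun he => h.notMem_right hv₁ (he ▸ hX₂A hx))]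
        omega

lemma ConnOn.exists_subcubic [Finite V] (hS : S.IsAcyclic) (hA : S.ConnOn A) {k : ℕ}
    (h : ¬ S.TdLE (2 * k) A) : ∃ X ⊆ A, S.ConnOn X ∧
      (∀ x ∈ X, (S.neighborSet x ∩ X).ncard ≤ 3) ∧ ¬ S.TdLE k X := by
  classical
  obtain ⟨v, hv⟩ := hA.1
  obtain ⟨X, hXA, hX, -, hdeg, htd⟩ := (exists_subcubic_marked hS k).1 A v hA hv h
  exact ⟨X, hXA, hX, fun x hx => (Nat.le_add_right _ _).trans (hdeg x hx), htd⟩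

end SimpleGraph

/-! ### The ancestor order and the greedy spanning tree -/

namespace SimpleGraph

lemma connOn_support {V : Type u} {G : SimpleGraph V} {a b : V} (p : G.Walk a b) :
    G.ConnOn {x | x ∈ p.support} := by
  induction p with
  | nil => simpa using connOn_singleton _
  | @cons a c b h p ih =>
    have : {x | x ∈ (Walk.cons h p).support} = {a} ∪ {x | x ∈ p.support} := by
      ext x; simp
    rw [this]
    exact (connOn_singleton a).join ih rfl p.start_mem_support h

namespace TreeDecomposition

variable {V : Type u} {G : SimpleGraph V} {N : Type v} (D : G.TreeDecomposition N)

lemma exists_rootPath (d : N) : ∃ p : D.tree.Walk D.root d, p.IsPath :=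
  (D.isTree.existsUnique_path D.root d).exists

variable {D}

lemma isAncestor_iff {d : N} {p : D.tree.Walk D.root d} (hp : p.IsPath) {a : N} :
    D.IsAncestor a d ↔ a ∈ p.support := by
  refine ⟨?_, fun h => ⟨p, hp, h⟩⟩
  rintro ⟨q, hq, ha⟩
  rwa [(D.isTree.existsUnique_path D.root d).unique hp hq]

lemma IsAncestor.refl (a : N) : D.IsAncestor a a := by
  obtain ⟨p, hp⟩ := D.exists_rootPath a
  exact ⟨p, hp, p.end_mem_support⟩

lemma root_isAncestor (a : N) : D.IsAncestor D.root a := by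
  obtain ⟨p, hp⟩ := D.exists_rootPath a
  exact ⟨p, hp, p.start_mem_support⟩

lemma connOn_ancestors (d : N) : D.tree.ConnOn {a | D.IsAncestor a d} := by
  obtain ⟨p, hp⟩ := D.exists_rootPath d
  simpa only [isAncestor_iff hp] using connOn_support p

lemma IsAncestor.mem_of_connOn {a d : N} (h : D.IsAncestor a d) {C : Set N}
    (hC : D.tree.ConnOn C) (hr : D.root ∈ C) (hd : d ∈ C) : a ∈ C := by
  classical
  obtain ⟨q⟩ := hC.induce_connected.preconnected ⟨D.root, hr⟩ ⟨d, hd⟩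
  let q' : D.tree.Walk D.root d := q.bypass.map (Embedding.induce C).toHom
  have hq' : q'.IsPath := q.bypass_isPath.map Subtype.val_injective
  rw [isAncestor_iff hq'] at h
  change a ∈ (q.bypass.map (Embedding.induce C).toHom).support at h
  rw [Walk.support_map] at h
  obtain ⟨z, -, rfl⟩ := List.mem_map.mp h
  exact z.2

lemma IsAncestor.trans {a b d : N} (hab : D.IsAncestor a b) (hbd : D.IsAncestor b d) :
    D.IsAncestor a d :=
  hab.mem_of_connOn (connOn_ancestors d) (root_isAncestor d) hbd

lemma IsAncestor.antisymm {a b : N} (hab : D.IsAncestor a b) (hba : D.IsAncestor b a) :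
    a = b := by
  classical
  obtain ⟨p, hp⟩ := D.exists_rootPath b
  have ha := (isAncestor_iff hp).mp hab
  by_contra hne
  exact Walk.endpoint_notMem_support_takeUntil hp ha (Ne.symm hne)
    ((isAncestor_iff (hp.takeUntil ha)).mp hba)

lemma IsAncestor.total {a b d : N} (had : D.IsAncestor a d) (hbd : D.IsAncestor b d) :
    D.IsAncestor a b ∨ D.IsAncestor b a := by
  obtain ⟨p, hp⟩ := D.exists_rootPath d
  have key : ∀ i j, i ≤ j → D.IsAncestor (p.getVert i) (p.getVert j) := by
    intro i j hij
    refine ⟨p.take j, hp.take j, ?_⟩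
    have := (p.take j).getVert_mem_support i
    rwa [Walk.take_getVert, min_eq_right hij] at this
  obtain ⟨i, rfl, -⟩ := Walk.mem_support_iff_exists_getVert.mp ((isAncestor_iff hp).mp had)
  obtain ⟨j, rfl, -⟩ := Walk.mem_support_iff_exists_getVert.mp ((isAncestor_iff hp).mp hbd)
  exact (le_total i j).imp (key i j) (key j i)

/-- The root path of `a` together with `C` is connected, hence contains the whole root path of `d`;
a node `b` on the root path of `a` would equal `a`. -/
lemma mem_of_isAncestor_of_isAncestor {C : Set N} (hC : D.tree.ConnOn C) {a b d : N}
    (ha : a ∈ C) (hd : d ∈ C) (hab : D.IsAncestor a b) (hbd : D.IsAncestor b d) : b ∈ C := by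
  have hU := (connOn_ancestors (D := D) a).union hC ⟨a, IsAncestor.refl a, ha⟩
  rcases hbd.mem_of_connOn hU (Or.inl (root_isAncestor a)) (Or.inr hd) with h | h
  · rwa [IsAncestor.antisymm h hab]
  · exact h

lemma isAncestor_or_of_tree_adj {a b : N} (hab : D.tree.Adj a b) :
    D.IsAncestor a b ∨ D.IsAncestor b a := by
  obtain ⟨p, hp⟩ := D.exists_rootPath a
  by_cases hb : b ∈ p.support
  · exact Or.inr ⟨p, hp, hb⟩
  · exact Or.inl ⟨p.concat hab, hp.concat hb hab, by simp [Walk.support_concat]⟩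

lemma exists_isChild {b : N} (hb : b ≠ D.root) :
    ∃ a, D.IsChild b a ∧ ∀ x, D.IsAncestor x b → x ≠ b → D.IsAncestor x a := by
  obtain ⟨p, hp⟩ := D.exists_rootPath b
  have hnil : ¬ p.Nil := fun h => hb h.eq.symm
  refine ⟨p.penultimate, ⟨p.adj_penultimate hnil, p, hp, p.getVert_mem_support _⟩,
    fun x hx hne => ⟨p.dropLast, hp.dropLast, ?_⟩⟩
  have hx' := (isAncestor_iff hp).mp hx
  rw [← Walk.support_dropLast_concat hnil] at hx'
  simpa [hne] using hx'

lemma IsChild.ne {a b : N} (h : D.IsChild b a) : a ≠ b := h.1.ne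

lemma IsChild.ne_root {a b : N} (h : D.IsChild b a) : b ≠ D.root := by
  rintro rfl
  exact h.ne (h.2.antisymm (root_isAncestor a))

lemma IsChild.eq {a a' b : N} (h : D.IsChild b a) (h' : D.IsChild b a') : a = a' := by
  have key : ∀ {a a'}, D.IsChild b a → D.IsChild b a' → D.IsAncestor a a' := by
    intro a a' h h'
    have hU := (connOn_ancestors (D := D) a').join (connOn_singleton b) (IsAncestor.refl a') rfl h'.1
    exact (h.2.mem_of_connOn hU (Or.inl (root_isAncestor a')) (Or.inr rfl)).resolve_right h.ne
  exact (key h h').antisymm (key h' h)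

lemma IsAncestor.exists_exit [Finite N] {A : Set N} {a w : N} (haw : D.IsAncestor a w)
    (ha : a ∈ A) (hw : w ∉ A) :
    ∃ p ∈ A, ∃ b ∉ A, D.IsChild b p ∧ D.IsAncestor a p ∧ D.IsAncestor b w := by
  obtain ⟨b, ⟨hbA, hab, hbw⟩, hmin⟩ := (Set.toFinite _).exists_minimalFor
    (fun b => {x | D.IsAncestor x b}.ncard)
    {b | b ∉ A ∧ D.IsAncestor a b ∧ D.IsAncestor b w} ⟨w, hw, haw, IsAncestor.refl w⟩
  have hne : a ≠ b := fun h => hbA (h ▸ ha)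
  have hbr : b ≠ D.root := by
    rintro rfl
    exact hne (hab.antisymm (root_isAncestor a))
  obtain ⟨p, hp, hmax⟩ := exists_isChild hbr
  have hap := hmax a hab hne
  refine ⟨p, ?_, b, hbA, hp, hap, hbw⟩
  by_contra hpA
  have hlt : {x | D.IsAncestor x p}.ncard < {x | D.IsAncestor x b}.ncard :=
    Set.ncard_lt_ncard ⟨fun x hx => IsAncestor.trans hx hp.2,
      fun h => hp.ne (hp.2.antisymm (h (IsAncestor.refl b)))⟩
  exact absurd (hmin ⟨hpA, hap, hp.2.trans hbw⟩ hlt.le) (not_le.mpr hlt)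

lemma exists_top_of_connOn [Finite N] {A : Set N} (hA : D.tree.ConnOn A) :
    ∃ a ∈ A, ∀ x ∈ A, D.IsAncestor a x :=
  hA.exists_top D.IsAncestor (fun a _ => IsAncestor.refl a) (fun _ _ => IsAncestor.antisymm)
    (fun _ _ _ => IsAncestor.trans) (fun _ _ _ => IsAncestor.total)
    fun _ _ _ _ => isAncestor_or_of_tree_adj

/-- If each node has a neighbour in the subtree of each of its children, then all subtrees are
connected. -/
lemma connOn_descendants [Finite V] {D : G.TreeDecomposition V} {S : SimpleGraph V}
    (hS : ∀ b a, D.IsChild b a → ∃ z, D.IsAncestor b z ∧ S.Adj a z) (v : V) :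
    S.ConnOn {x | D.IsAncestor v x} := by
  induction hn : {x | D.IsAncestor v x}.ncard using Nat.strong_induction_on generalizing v with
  | _ n ih =>
  have hchild : ∀ c, D.IsChild c v → S.ConnOn {x | D.IsAncestor c x} := by
    intro c hc
    refine ih _ ?_ c rfl
    rw [← hn]
    exact Set.ncard_lt_ncard ⟨fun x hx => hc.2.trans hx,
      fun h => hc.ne (hc.2.antisymm (h (IsAncestor.refl v)))⟩
  have hcase : ∀ x, D.IsAncestor v x → x ≠ v → ∃ c, D.IsChild c v ∧ D.IsAncestor c x := by
    intro x hx hne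
    obtain ⟨p, rfl, b, -, hb, -, hbx⟩ := hx.exists_exit (A := {v}) rfl hne
    exact ⟨b, hb, hbx⟩
  refine connOn_of_subset (x := v) (IsAncestor.refl v) fun B hB hne hcl => ?_
  have hcl' : ∀ c, D.IsChild c v → ∀ a ∈ {x | D.IsAncestor c x}, a ∈ B →
      ∀ y ∈ {x | D.IsAncestor c x}, S.Adj a y → y ∈ B :=
    fun c hc a _ ha y hy hay => hcl a ha y (hc.2.trans hy) hay
  have hv : v ∈ B := by
    obtain ⟨y, hy⟩ := hne
    by_cases hyv : y = v
    · rwa [← hyv]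
    obtain ⟨c, hc, hcy⟩ := hcase y (hB hy) hyv
    obtain ⟨z, hz, hvz⟩ := hS c v hc
    have := (hchild c hc).subset_of hcy hy (hcl' c hc)
    exact hcl z (this hz) v (IsAncestor.refl v) hvz.symm
  intro x hx
  by_cases hxv : x = v
  · rwa [hxv]
  obtain ⟨c, hc, hcx⟩ := hcase x hx hxv
  obtain ⟨z, hz, hvz⟩ := hS c v hc
  exact (hchild c hc).subset_of hz (hcl v hv z (hc.2.trans hz) hvz) (hcl' c hc) hcx

/-- A greedy tree decomposition yields a spanning tree in which all subtrees of the decomposition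
tree are connected. -/
lemma IsGreedy.exists_spanningTree [Finite V] {D : G.TreeDecomposition V} (hD : D.IsGreedy) :
    ∃ S ≤ G, S.IsTree ∧ ∀ v, S.ConnOn {x | D.IsAncestor v x} := by
  have hpar : ∀ b, ∃ a z, b ≠ D.root → D.IsChild b a ∧ D.IsAncestor b z ∧ G.Adj a z := by
    intro b
    by_cases hb : b = D.root
    · exact ⟨b, b, fun h => absurd hb h⟩
    · obtain ⟨a, ha, -⟩ := exists_isChild hb
      obtain ⟨z, hz⟩ := hD.exists_adj_of_isChild a b ha
      exact ⟨a, z, fun _ => ⟨ha, hz⟩⟩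
  choose a z haz using hpar
  let E : Set (Sym2 V) := (fun b => s(a b, z b)) '' {b | b ≠ D.root}
  let S := fromEdgeSet E
  have hconn : ∀ v, S.ConnOn {x | D.IsAncestor v x} := by
    refine connOn_descendants fun b a' hb => ?_
    obtain ⟨hab, hbz, hadj⟩ := haz b hb.ne_root
    obtain rfl := hab.eq hb
    exact ⟨z b, hbz, (fromEdgeSet_adj E).mpr ⟨⟨b, hb.ne_root, rfl⟩, hadj.ne⟩⟩
  have huniv : S.Connected := by
    have h1 := (hconn D.root).induce_connected
    rw [Set.eq_univ_of_forall (s := {x | D.IsAncestor D.root x}) root_isAncestor] at h1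
    exact (Iso.connected_iff (induceUnivIso S)).mp h1
  refine ⟨S, ?_, ?_, hconn⟩
  · intro x y hxy
    obtain ⟨⟨b, hb, he⟩, -⟩ := (fromEdgeSet_adj E).mp hxy
    have := (haz b hb).2.2
    rwa [← mem_edgeSet, ← show s(a b, z b) = s(x, y) from he, mem_edgeSet]
  -- The edges are indexed, perhaps with repetition, by the non-root vertices, so a connected `S`
  -- has exactly one edge fewer than vertices.
  · rw [isTree_iff_connected_and_card]
    refine ⟨huniv, le_antisymm ?_ huniv.card_vert_le_card_edgeSet_add_one⟩
    have h1 : S.edgeSet.ncard ≤ {b | b ≠ D.root}.ncard := by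
      refine (Set.ncard_le_ncard (t := E) ?_ (Set.toFinite _)).trans
        (Set.ncard_image_le (Set.toFinite _))
      rw [edgeSet_fromEdgeSet]
      exact Set.sdiff_subset
    have h2 : {b : V | b ≠ D.root}.ncard < (Set.univ : Set V).ncard :=
      Set.ncard_lt_ncard ⟨Set.subset_univ _, fun h => h (Set.mem_univ D.root) rfl⟩
    rw [Set.ncard_univ] at h2
    rw [Nat.card_coe_set_eq]
    omega

end TreeDecomposition

end SimpleGraph

/-! ### Deleting marked vertices of a tree in logarithmic depth -/

namespace SimpleGraph

section Weights

variable {V : Type u} {T : SimpleGraph V} {A C X : Set V}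

/-- The vertices of `C` that have a neighbour outside `C`. -/
def innerBoundary (T : SimpleGraph V) (C : Set V) : Set V :=
  {p | p ∈ C ∧ ∃ q, q ∉ C ∧ T.Adj p q}

/-- Deleting `x` from `C` adds at most one vertex to the part of `X` and of the inner boundary in
each of the components. -/
lemma ncard_marked_compOn_le [Finite V] (hT : T.IsAcyclic) {x y : V}
    (hy : y ∈ C \ {x}) :
    ((X ∩ T.compOn (C \ {x}) y) ∪ T.innerBoundary (T.compOn (C \ {x}) y)).ncard ≤
      (((X ∩ C) ∪ T.innerBoundary C) ∩ T.compOn (C \ {x}) y).ncard + 1 := by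
  set K := T.compOn (C \ {x}) y with hK
  have hKC : K ⊆ C \ {x} := compOn_subset hy
  have hKconn : T.ConnOn K := connOn_compOn y
  -- A boundary vertex of `K` that is not one of `C` is adjacent to `x`, and a connected set in a
  -- forest has at most one neighbour of `x`.
  have hone : {z | z ∈ K ∧ T.Adj x z}.ncard ≤ 1 := by
    rw [Set.ncard_le_one_iff]
    intro z z' hz hz'
    exact hKconn.eq_of_adj hT (fun h => (hKC h).2 rfl) hz.1 hz'.1 hz.2 hz'.2
  refine le_trans (Set.ncard_le_ncard (t := (((X ∩ C) ∪ T.innerBoundary C) ∩ K) ∪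
    {z | z ∈ K ∧ T.Adj x z}) ?_ (Set.toFinite _))
    ((Set.ncard_union_le _ _).trans (Nat.add_le_add_left hone _))
  rintro z (⟨hzX, hzK⟩ | ⟨hzK, q, hqK, hzq⟩)
  · exact Or.inl ⟨Or.inl ⟨hzX, (hKC hzK).1⟩, hzK⟩
  · by_cases hqx : q = x
    · exact Or.inr ⟨hzK, hqx ▸ hzq.symm⟩
    · refine Or.inl ⟨Or.inr ⟨(hKC hzK).1, q, fun hqC => hqK ?_, hzq⟩, hzK⟩
      exact compOn_closed hzK ⟨hqC, hqx⟩ hzq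

/-- Deleting a vertex of `X` removes one mark and creates at most one new boundary mark per
component, so the bound three persists while `X ∩ C` shrinks. -/
lemma tdLE_of_ncard_marked_le_three [Finite V] (hT : T.IsAcyclic) {n : ℕ}
    (h : ∀ K ⊆ A, T.ConnOn K → X ∩ K = ∅ → (T.innerBoundary K).ncard ≤ 3 → T.TdLE n K) (i : ℕ)
    (hCA : C ⊆ A) (hC : T.ConnOn C) (h3 : ((X ∩ C) ∪ T.innerBoundary C).ncard ≤ 3)
    (hi : (X ∩ C).ncard ≤ i) : T.TdLE (n + i) C := by
  have hdone : X ∩ C = ∅ → T.TdLE n C := by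
    intro he
    refine h C hCA hC he ?_
    rwa [he, Set.empty_union] at h3
  induction i generalizing C with
  | zero => exact hdone ((Set.ncard_eq_zero).mp (Nat.le_zero.mp hi))
  | succ i ih =>
    rcases (X ∩ C).eq_empty_or_nonempty with he | ⟨x, hxX, hxC⟩
    · exact (hdone he).mono (Nat.le_add_right _ _)
    refine TdLE.of_diff_singleton (x := x) (tdLE_of_forall_compOn fun y hy => ?_)
    have hKC := compOn_subset (G := T) hy
    have hxK : x ∉ T.compOn (C \ {x}) y := fun hx => (hKC hx).2 rfl
    have h1 := ncard_marked_compOn_le (X := X) hT hy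
    have h2 : (((X ∩ C) ∪ T.innerBoundary C) ∩ T.compOn (C \ {x}) y).ncard <
        ((X ∩ C) ∪ T.innerBoundary C).ncard :=
      Set.ncard_lt_ncard ⟨Set.inter_subset_left, fun hs => hxK (hs (Or.inl ⟨hxX, hxC⟩)).2⟩
    have h4 : (X ∩ T.compOn (C \ {x}) y).ncard < (X ∩ C).ncard :=
      Set.ncard_lt_ncard ⟨Set.inter_subset_inter_right _ (hKC.trans Set.sdiff_subset),
        fun hs => hxK (hs ⟨hxX, hxC⟩).2⟩
    have hKA := (hKC.trans Set.sdiff_subset).trans hCA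
    have h5 : ((X ∩ T.compOn (C \ {x}) y) ∪ T.innerBoundary (T.compOn (C \ {x}) y)).ncard ≤ 3 := by
      omega
    refine ih hKA (connOn_compOn y) h5 (by omega) fun he => ?_
    refine h _ hKA (connOn_compOn y) he ?_
    rwa [he, Set.empty_union] at h5

/-- In a tree, a set `X` is deleted in logarithmic depth such that the remaining components have an
inner boundary of at most three vertices. -/
lemma tdLE_of_ncard_marked_le [Finite V] (hT : T.IsAcyclic) {n : ℕ}
    (h : ∀ K ⊆ A, T.ConnOn K → X ∩ K = ∅ → (T.innerBoundary K).ncard ≤ 3 → T.TdLE n K) (l : ℕ)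
    (hCA : C ⊆ A) (hC : T.ConnOn C) (hl : ((X ∩ C) ∪ T.innerBoundary C).ncard ≤ 2 ^ l + 2) :
    T.TdLE (n + 3 + l) C := by
  induction l generalizing C with
  | zero =>
    refine tdLE_of_ncard_marked_le_three hT h 3 hCA hC hl ?_
    exact (Set.ncard_le_ncard Set.subset_union_left (Set.toFinite _)).trans hl
  | succ l ih =>
    set M := (X ∩ C) ∪ T.innerBoundary C with hM
    -- The offset 2 balances the recursion: components at a centroid have at most `2 ^ l + 1` old
    -- marks and at most one new one, while two sides with `2 ^ l + 2` marks each would exceed `2 ^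
    -- (l + 1) + 2`.
    rcases hC.exists_centroid_or_isSplit hT (fun B => 2 ^ l + 2 ≤ (M ∩ B).ncard)
      (fun B B' hB hle => hle.trans (Set.ncard_le_ncard (Set.inter_subset_inter_right _ hB)
        (Set.toFinite _))) with ⟨x, -, hx⟩ | ⟨A₁, A₂, u, w, hs, h₁, h₂⟩
    · refine TdLE.of_diff_singleton (x := x) (tdLE_of_forall_compOn fun y hy => ?_)
      have hKC := compOn_subset (G := T) hy
      have h1 := ncard_marked_compOn_le (X := X) hT hy
      have h2 := hx _ hKC (connOn_compOn y)
      rw [← hM] at h1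
      refine ih ((hKC.trans Set.sdiff_subset).trans hCA) (connOn_compOn y) ?_
      omega
    · exfalso
      have hd : Disjoint (M ∩ A₁) (M ∩ A₂) :=
        hs.disjoint.mono Set.inter_subset_right Set.inter_subset_right
      have h1 := Set.ncard_union_eq hd (Set.toFinite _) (Set.toFinite _)
      have h2 : ((M ∩ A₁) ∪ (M ∩ A₂)).ncard ≤ M.ncard :=
        Set.ncard_le_ncard (Set.union_subset Set.inter_subset_left Set.inter_subset_left)
          (Set.toFinite _)
      rw [pow_succ] at hl
      omega

end Weights

/-! ### Treedepth of the decomposition tree against the spanning tree -/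

namespace TreeDecomposition

variable {V : Type u} {G S : SimpleGraph V} {D : G.TreeDecomposition V}

lemma connOn_mem_bag (D : G.TreeDecomposition V) (x : V) : D.tree.ConnOn {t | x ∈ D.bag t} :=
  connOn_of_induce_connected (D.connected_bags x)

/-- The bags on the way from a vertex down to a neighbour contain the vertex. -/
lemma IsGreedy.mem_bag_of_adj (hD : D.IsGreedy) {x y t : V} (hxy : G.Adj x y)
    (hxt : D.IsAncestor x t) (hty : D.IsAncestor t y) : x ∈ D.bag t := by
  obtain ⟨s, hxs, hys⟩ := D.exists_bag_of_adj x y hxy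
  exact mem_of_isAncestor_of_isAncestor (D.connOn_mem_bag x) (hD.mem_bag_self x) hxs hxt
    (hty.trans (hD.isAncestor_of_mem_bag y s hys))

/-- A component of a connected piece `A` of the decomposition tree contains the top of `A`, or a
vertex of a bag of the inner boundary. -/
lemma IsGreedy.exists_mem_compOn [Finite V] (hD : D.IsGreedy) (hSG : S ≤ G)
    (hS : ∀ v, S.ConnOn {x | D.IsAncestor v x}) {A : Set V} (hA : D.tree.ConnOn A) {a : V}
    (ha : a ∈ A) (htop : ∀ x ∈ A, D.IsAncestor a x) {c : V} (hc : c ∈ A) :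
    a ∈ S.compOn A c ∨ ∃ u ∈ S.compOn A c, ∃ p ∈ D.tree.innerBoundary A, u ∈ D.bag p := by
  rw [or_iff_not_imp_left]
  intro haK
  have hKA := compOn_subset (G := S) hc
  obtain ⟨u, hu, w, hw, hwK, huw⟩ := (hS a).exists_adj (B := S.compOn A c)
    (fun x hx => htop x (hKA hx)) ⟨c, mem_compOn_self c⟩
    (fun h => haK (h.symm.subset (IsAncestor.refl a)))
  have hwA : w ∉ A := fun hwA => hwK (compOn_closed hu hwA huw)
  have huA := hKA hu
  -- The way from `a` down to `w` leaves `A` at `p`. As `A` is convex, `u` is not below `b`; so `u`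
  -- lies above `p` and `w` below it, and the edge `uw` forces `u` into the bag of `p`.
  obtain ⟨p, hpA, b, hbA, hbp, hap, hbw⟩ := IsAncestor.exists_exit hw ha hwA
  have hbu : ¬ D.IsAncestor b u := fun h =>
    hbA (mem_of_isAncestor_of_isAncestor hA ha huA (hap.trans hbp.2) h)
  have huw' : D.IsAncestor u w :=
    (hD.isAncestor_or_of_adj u w (hSG huw)).resolve_right fun h => hbu (hbw.trans h)
  have hub : D.IsAncestor u b := (huw'.total hbw).resolve_right hbu
  have hup : D.IsAncestor u p := by
    obtain ⟨p', hp', hmax⟩ := exists_isChild hbp.ne_root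
    rw [hbp.eq hp']
    exact hmax u hub fun h => hbA (h ▸ huA)
  exact ⟨u, hu, p, ⟨hpA, b, hbA, hbp.1⟩, hD.mem_bag_of_adj (hSG huw) hup (hbp.2.trans hbw)⟩

/-- The decomposition tree has treedepth at most logarithmically larger than that of a spanning
subgraph in which the subtrees of the decomposition tree are connected. -/
lemma IsGreedy.tdLE_tree [Finite V] (hD : D.IsGreedy) (hSG : S ≤ G)
    (hS : ∀ v, S.ConnOn {x | D.IsAncestor v x}) {m l : ℕ} (hm : ∀ t, (D.bag t).card ≤ m)
    (hl : 3 * m + 2 ≤ 2 ^ l) (d : ℕ) {A : Set V} (hA : D.tree.ConnOn A)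
    (hbd : (D.tree.innerBoundary A).ncard ≤ 3) (htd : S.TdLE d A) :
    D.tree.TdLE (d * (l + 3)) A := by
  classical
  induction d generalizing A with
  | zero => exact absurd htd hA.1.ne_empty
  | succ d ih =>
    obtain ⟨a, ha, htop⟩ := exists_top_of_connOn hA
    -- `f u` is a vertex whose deletion lowers the treedepth bound of the component of `u`. It may
    -- depend on the representative `u`: deleting one such vertex per component suffices.
    have hf : ∀ u, ∃ x, u ∈ A → S.TdLE d (S.compOn A u \ {x}) := by
      intro u
      by_cases hu : u ∈ A
      · obtain ⟨x, -, hx⟩ := htd _ (compOn_subset hu) (connOn_compOn u)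
        exact ⟨x, fun _ => hx⟩
      · exact ⟨u, fun h => absurd h hu⟩
    choose f hf using hf
    have hfin : (D.tree.innerBoundary A).Finite := Set.toFinite _
    let M : Finset V := hfin.toFinset.biUnion D.bag
    have hMcard : M.card ≤ 3 * m := by
      refine (Finset.card_biUnion_le_card_mul _ _ m fun t _ => hm t).trans ?_
      rw [← Set.ncard_eq_toFinset_card]
      exact Nat.mul_le_mul_right _ hbd
    let X : Finset V := insert (f a) (M.image f)
    have hX : (X : Set V).ncard ≤ 3 * m + 1 := by
      rw [Set.ncard_coe_finset]
      exact (Finset.card_insert_le _ _).trans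
        (Nat.succ_le_succ (Finset.card_image_le.trans hMcard))
    -- At most `3m + 1` vertices of `X` and three boundary vertices; this fixes the requirement `3m
    -- + 2 ≤ 2 ^ l`.
    have hw : (((X : Set V) ∩ A) ∪ D.tree.innerBoundary A).ncard ≤ 2 ^ l + 2 := by
      have h1 := Set.ncard_union_le ((X : Set V) ∩ A) (D.tree.innerBoundary A)
      have h2 : ((X : Set V) ∩ A).ncard ≤ (X : Set V).ncard :=
        Set.ncard_le_ncard Set.inter_subset_left (Set.toFinite _)
      omega
    have := tdLE_of_ncard_marked_le D.isTree.isAcyclic (X := (X : Set V)) (A := A)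
      (n := d * (l + 3)) ?_ l le_rfl hA hw
    · rwa [show (d + 1) * (l + 3) = d * (l + 3) + 3 + l by ring]
    · intro K hKA hK hXK hKbd
      -- A connected subset of `K` lies in one component of S[A] and avoids the vertex of `X` chosen
      -- for it, so its treedepth is at most `d`.
      refine ih hK hKbd (tdLE_of_forall_connOn fun C hCK hC => ?_)
      have key : ∀ u ∈ A, f u ∈ X → (u ∈ S.compOn A hC.1.some) → S.TdLE d C := by
        intro u hu hfu huc
        refine (hf u hu).mono_set fun x hx => ⟨?_, ?_⟩
        · rw [compOn_eq_of_mem (hKA (hCK hC.1.some_mem)) huc]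
          exact hC.subset_compOn (hCK.trans hKA) hC.1.some_mem (mem_compOn_self _) hx
        · rintro rfl
          have : f u ∈ (X : Set V) ∩ K := ⟨hfu, hCK hx⟩
          rw [hXK] at this
          exact this
      have hcA : hC.1.some ∈ A := hKA (hCK hC.1.some_mem)
      rcases hD.exists_mem_compOn hSG hS hA ha htop hcA with h | ⟨u, hu, p, hp, hup⟩
      · exact key a ha (Finset.mem_insert_self _ _) h
      · refine key u (compOn_subset hcA hu) (Finset.mem_insert_of_mem ?_) hu
        exact Finset.mem_image_of_mem f
          (Finset.mem_biUnion.mpr ⟨p, hfin.mem_toFinset.mpr hp, hup⟩)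

end TreeDecomposition

end SimpleGraph

/-! ### Constants and conclusion -/

namespace SimpleGraph

/-- A connected vertex set of a spanning forest gives a subtree. -/
lemma ConnOn.exists_subgraph {V : Type u} [Finite V] {G S : SimpleGraph V} (hSG : S ≤ G)
    (hS : S.IsAcyclic) {X : Set V} (hX : S.ConnOn X)
    (hdeg : ∀ x ∈ X, (S.neighborSet x ∩ X).ncard ≤ 3) {k : ℕ} (htd : ¬ S.TdLE k X) :
    ∃ H : G.Subgraph, H.coe.IsTree ∧ (∀ x ∈ H.verts, (H.neighborSet x).ncard ≤ 3) ∧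
      k + 1 ≤ H.coe.treedepth := by
  let H : G.Subgraph :=
    { verts := X
      Adj := fun a b => S.Adj a b ∧ a ∈ X ∧ b ∈ X
      adj_sub := fun h => hSG h.1
      edge_vert := fun h => h.2.1
      symm := ⟨fun _ _ h => ⟨h.1.symm, h.2.2, h.2.1⟩⟩ }
  have hcoe : H.coe = S.induce X := by
    ext a b
    exact ⟨fun h => h.1, fun h => ⟨h, a.2, b.2⟩⟩
  refine ⟨H, ?_, fun x hx => ?_, ?_⟩
  · rw [hcoe]
    exact ⟨hX.induce_connected, hS.induce X⟩
  · refine (Set.ncard_le_ncard ?_ (Set.toFinite _)).trans (hdeg x hx)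
    exact fun y hy => ⟨hy.1, hy.2.2⟩
  · rw [hcoe]
    by_contra! hlt
    exact htd ((tdLE_treedepth_induce S X).mono (by omega))

lemma exists_pow_ge_of_two_le {τ : ℝ} (hτ : 2 ≤ τ) :
    ∃ l : ℕ, 3 * ⌊τ⌋₊ + 2 ≤ 2 ^ l ∧ ((l : ℝ) + 3) ≤ 7 * Real.logb 2 τ := by
  have hpos : 0 < τ := by linarith
  have hlog : 1 ≤ Real.logb 2 τ := by
    rw [Real.le_logb_iff_rpow_le (by norm_num) hpos]
    simpa using hτ
  -- The extra 2 gives `2 ^ l ≥ 4τ ≥ 3τ + 2`; then `l + 3 ≤ log τ + 6 ≤ 7 log τ`, as `log τ ≥ 1`.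
  refine ⟨⌈Real.logb 2 τ⌉₊ + 2, ?_, ?_⟩
  · have h1 : τ ≤ (2 : ℝ) ^ ⌈Real.logb 2 τ⌉₊ := by
      rw [← Real.rpow_natCast, ← Real.logb_le_iff_le_rpow (by norm_num) hpos]
      exact Nat.le_ceil _
    have h2 : (⌊τ⌋₊ : ℝ) ≤ τ := Nat.floor_le hpos.le
    have h3 : ((3 * ⌊τ⌋₊ + 2 : ℕ) : ℝ) ≤ ((2 ^ (⌈Real.logb 2 τ⌉₊ + 2) : ℕ) : ℝ) := by
      push_cast
      rw [pow_add]
      linarith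
    exact_mod_cast h3
  · have := (Nat.ceil_lt_add_one (by linarith : 0 ≤ Real.logb 2 τ)).le
    push_cast
    linarith

end SimpleGraph

open SimpleGraph in
theorem lemma7 :
    ∃ c : ℝ, 0 < c ∧
      ∀ (V : Type u) [Finite V] (G : SimpleGraph V), G.Connected →
        ∀ D : G.TreeDecomposition V, D.IsGreedy →
          ∀ τ : ℝ, 2 ≤ τ → (∀ t : V, ((D.bag t).card : ℝ) ≤ τ) →
            ∃ H : G.Subgraph, H.coe.IsTree ∧
              (∀ x ∈ H.verts, (H.neighborSet x).ncard ≤ 3) ∧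
              c * ((D.tree.treedepth : ℝ) / Real.logb 2 τ) ≤ (H.coe.treedepth : ℝ) := by
  classical
  -- 14 = 2 · 7: a factor 2 from passing to a subcubic subtree and 7 from `l + 3 ≤ 7 log τ`.
  refine ⟨1 / 14, by norm_num, fun V _ G _ D hD τ hτ hbag => ?_⟩
  obtain ⟨S, hSG, hS, hconn⟩ := hD.exists_spanningTree
  obtain ⟨l, hl, hlτ⟩ := exists_pow_ge_of_two_le hτ
  have huniv : S.ConnOn Set.univ := connOn_univ_of_connected hS.connected
  have hex : ∃ d, S.TdLE d Set.univ := ⟨_, exists_tdLE S Set.univ⟩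
  have hd := Nat.find_spec hex
  have hmin := fun k => Nat.find_min hex (m := k)
  generalize Nat.find hex = d at hd hmin
  have hd0 : d ≠ 0 := by
    rintro rfl
    exact huniv.1.ne_empty hd
  have hT : D.tree.treedepth ≤ d * (l + 3) := by
    refine (hD.tdLE_tree hSG hconn (fun t => Nat.le_floor (hbag t)) hl d
      (connOn_univ_of_connected D.isTree.connected) ?_ hd).treedepth_le
    have : D.tree.innerBoundary Set.univ = ∅ :=
      Set.eq_empty_of_forall_notMem fun p hp => hp.2.choose_spec.1 (Set.mem_univ _)
    simp [this]
  -- With `d` the least bound for `S`, `2k ≤ d - 1` is not a bound, and the resulting treedepth `k +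
  -- 1` is at least `d / 2`.
  obtain ⟨X, -, hX, hdeg, htd⟩ := huniv.exists_subcubic hS.isAcyclic (k := (d - 1) / 2)
    fun h => hmin _ (by omega) h
  obtain ⟨H, hH, hHdeg, hHtd⟩ := hX.exists_subgraph hSG hS.isAcyclic hdeg htd
  refine ⟨H, hH, hHdeg, ?_⟩
  have h1 : (D.tree.treedepth : ℝ) ≤ d * ((l : ℝ) + 3) := by exact_mod_cast hT
  have h2 : (d : ℝ) ≤ 2 * H.coe.treedepth := by
    have : d ≤ 2 * H.coe.treedepth := by omega
    exact_mod_cast this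
  have hlog : 0 < Real.logb 2 τ := Real.logb_pos (by norm_num) (by linarith)
  rw [mul_div_assoc', div_le_iff₀ hlog]
  have h3 : (d : ℝ) * ((l : ℝ) + 3) ≤ d * (7 * Real.logb 2 τ) := by gcongr
  have h4 : (d : ℝ) * (7 * Real.logb 2 τ) ≤ 2 * H.coe.treedepth * (7 * Real.logb 2 τ) := by gcongr
  linarith
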